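/- Let $n\ge 1$, $1\le k\le n$, $p>1$, $\alpha>-1$, $\beta<p-1$, $c\ge 0$ and $f(t)=e^{ct}$. For $\lambda\in\mathbb R^n$ put $$S_k(\lambda)=\sum_{i_1<\dots<i_k}\lambda_{i_1}\cdots\lambda_{i_k},\qquad \Pi_k(\lambda)=\prod_{i_1<\dots<i_k}(\lambda_{i_1}+\dots+\lambda_{i_k}),$$ $$\Gamma_k=\{\lambda: S_i(\lambda)>0,\ i=1,\dots,k\},\qquad \mathcal P_k=\{\lambda:\lambda_{i_1}+\dots+\lambda_{i_k}>0\ \text{ for all } i_1<\dots<i_k\}.$$ Consider the equations $$S_k^{1/k}\big[D(|Du|^{p-2}Du)\big]=|x|^\alpha|Du|^\beta f(u)\quad\text{in }\mathbb R^n,\tag{1.5}$$ $$\Pi_k^{1/\binom nk}\big[D(|Du|^{p-2}Du)\big]=|x|^\alpha|Du|^\beta f(u)\quad\text{in }\mathbb R^n,\tag{1.6}$$ where the operators are evaluated at the eigenvalues $\lambda$ of the matrix $D(|Du|^{p-2}Du)$, and $|Du|^{p-2}Du:=0$ where $Du=0$. An *entire nontrivial admissible subsolution* of (1.5) is a nonconstant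 function $u\in C^1(\mathbb R^n)\cap C^2(\mathbb R^n\setminus\{0\})$ such that, at every $x\ne 0$, the field $|Du|^{p-2}Du$ is differentiable, the eigenvalues of $D(|Du|^{p-2}Du)$ are real and form a vector in $\Gamma_k$, and the left-hand side of (1.5) is $\ge$ the right-hand side (for $\beta<0$ the right-hand side is $+\infty$ where $Du=0$, so that $Du\neq0$ is required; $|Du|^0=1$). For (1.6) the definition is the same with $\mathcal P_k$ in place of $\Gamma_k$. Then, for equation (1.5) with $\alpha_0=\frac1k-1$, and for equation (1.6) with $\alpha_0=\frac kn-1$: (i) if $p\le\alpha+\beta+2$, the equation has an entire nontrivial admissible subsolution $u\in C^2(\mathbb R^n)$ if and only if $c=0$; (ii) if $p>\alpha+\beta+2$ and $(p-1)\alpha+\beta\ge0$, then for every $\delta\in\big(1,\frac{p-\beta-1}{p-\alpha-\beta-2}\big)$ the equation has an entire nontrivial admissible subsolution $u\in W^{2,\delta}_{loc}(\mathbb R^n)$ if and only if $c=0$; (iii) if $\alpha<\alpha_0$ (with no further condition on $p,\alpha,\beta$), the equation has an entire nontrivial admissible subsolution if and only if $c=0$. -/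

import Mathlib

noncomputable section

/-- Euclidean space `ℝⁿ`. -/
abbrev RSpace (n : ℕ) : Type := EuclideanSpace ℝ (Fin n)

/-- The vector field `|Du|^{p-2} Du` (with value `0` where `Du = 0`). -/
def pGradient {n : ℕ} (p : ℝ) (u : RSpace n → ℝ) (x : RSpace n) : RSpace n :=
  ‖gradient u x‖ ^ (p - 2) • gradient u x

/-- `lam` lists the eigenvalues of `A`, all of them real, with algebraic multiplicity. It is
determined by `A` up to a permutation of the coordinates. -/
def IsEigenvalueVector {n : ℕ} (A : RSpace n →L[ℝ] RSpace n) (lam : Fin n → ℝ) : Prop :=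
  (A : RSpace n →ₗ[ℝ] RSpace n).charpoly =
    ∏ i, (Polynomial.X - Polynomial.C (lam i))

/-- `S_k(λ)`, the sum of all `k`-fold products `λ_{i_1} ⋯ λ_{i_k}`, `i_1 < ⋯ < i_k`. -/
def sumOfProducts {n : ℕ} (k : ℕ) (lam : Fin n → ℝ) : ℝ :=
  ∑ s ∈ Finset.powersetCard k (Finset.univ : Finset (Fin n)), ∏ i ∈ s, lam i

/-- `Π_k(λ)`, the product of all `k`-fold sums `λ_{i_1} + ⋯ + λ_{i_k}`, `i_1 < ⋯ < i_k`. -/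
def productOfSums {n : ℕ} (k : ℕ) (lam : Fin n → ℝ) : ℝ :=
  ∏ s ∈ Finset.powersetCard k (Finset.univ : Finset (Fin n)), ∑ i ∈ s, lam i

/-- Gårding's cone `Γ_k = {λ : S_i(λ) > 0, i = 1, …, k}`. -/
def gardingCone (n k : ℕ) : Set (Fin n → ℝ) :=
  {lam | ∀ i : ℕ, 1 ≤ i → i ≤ k → 0 < sumOfProducts i lam}

/-- The cone `P_k = {λ : λ_{i_1} + ⋯ + λ_{i_k} > 0 for all i_1 < ⋯ < i_k}`. -/
def sumCone (n k : ℕ) : Set (Fin n → ℝ) :=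
  {lam | ∀ s ∈ Finset.powersetCard k (Finset.univ : Finset (Fin n)), 0 < ∑ i ∈ s, lam i}

/-- `u` is a nontrivial (that is, nonconstant) admissible subsolution of
`F(λ(D(|Du|^{p-2}Du))) = |x|^α |Du|^β f(u)` relative to the cone `K`: at every `x ≠ 0` the field
`|Du|^{p-2}Du` is differentiable, the eigenvalues of its derivative lie in `K`, and
`F(λ(D(|Du|^{p-2}Du))) ≥ |x|^α |Du|^β f(u)`. If `β < 0`, the right-hand side is infinite where
`Du = 0`, so `Du` must not vanish. (At the origin the weights are in general undefined.) -/
def IsAdmissibleSubsolution {n : ℕ} (K : Set (Fin n → ℝ)) (F : (Fin n → ℝ) → ℝ)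
    (p α β : ℝ) (f : ℝ → ℝ) (u : RSpace n → ℝ) : Prop :=
  (∃ x y, u x ≠ u y) ∧
  ∀ x : RSpace n, x ≠ 0 →
    DifferentiableAt ℝ (pGradient p u) x ∧
    (β < 0 → gradient u x ≠ 0) ∧
    ∃ lam : Fin n → ℝ, IsEigenvalueVector (fderiv ℝ (pGradient p u) x) lam ∧
      lam ∈ K ∧
      ‖x‖ ^ α * ‖gradient u x‖ ^ β * f (u x) ≤ F lam

/-- Nontrivial admissible subsolution of `S_k^{1/k}[D(|Du|^{p-2}Du)] = |x|^α |Du|^β f(u)`. -/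
def IsSubsolutionS {n : ℕ} (k : ℕ) (p α β : ℝ) (f : ℝ → ℝ) (u : RSpace n → ℝ) : Prop :=
  IsAdmissibleSubsolution (gardingCone n k)
    (fun lam => sumOfProducts k lam ^ (1 / (k : ℝ))) p α β f u

/-- Nontrivial admissible subsolution of
`Π_k^{1/C(n,k)}[D(|Du|^{p-2}Du)] = |x|^α |Du|^β f(u)`. -/
def IsSubsolutionPi {n : ℕ} (k : ℕ) (p α β : ℝ) (f : ℝ → ℝ) (u : RSpace n → ℝ) : Prop :=
  IsAdmissibleSubsolution (sumCone n k)
    (fun lam => productOfSums k lam ^ (1 / (n.choose k : ℝ))) p α β f u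

/-- `u ∈ L^δ_loc(ℝⁿ)`. -/
def MemLpLocal {n : ℕ} (δ : ℝ) (u : RSpace n → ℝ) : Prop :=
  ∀ K : Set (RSpace n), IsCompact K →
    MeasureTheory.MemLp u (ENNReal.ofReal δ) (MeasureTheory.volume.restrict K)

/-- `g` is the weak partial derivative `∂_i u` on `ℝⁿ` (for locally integrable `u`, `g`). -/
def IsWeakPartial {n : ℕ} (i : Fin n) (u g : RSpace n → ℝ) : Prop :=
  ∀ φ : RSpace n → ℝ, ContDiff ℝ ((⊤ : ℕ∞) : WithTop ℕ∞) φ → HasCompactSupport φ →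
    ∫ x, u x * fderiv ℝ φ x (EuclideanSpace.single i 1) = -∫ x, g x * φ x

/-- `u ∈ W^{2,δ}_loc(ℝⁿ)`: `u` and its weak derivatives of order one and two are
in `L^δ_loc(ℝⁿ)`. -/
def MemSobolevTwoLocal {n : ℕ} (δ : ℝ) (u : RSpace n → ℝ) : Prop :=
  MemLpLocal δ u ∧
  ∃ (g : Fin n → RSpace n → ℝ) (h : Fin n → Fin n → RSpace n → ℝ),
    (∀ i, MemLpLocal δ (g i) ∧ IsWeakPartial i u (g i)) ∧
    (∀ i j, MemLpLocal δ (h i j) ∧ IsWeakPartial j (g i) (h i j))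

end

/-!
On its cone each operator `F` is bounded above by a multiple of the trace, and on the positive
orthant it is bounded below by the smallest eigenvalue.

If `c ≤ 0`, then `e^{ct} ≤ 1` for `t ≥ 0`, so it suffices to solve the inequality with `f = 1` by
a nonnegative function: for `γ = 1 + (α + 1) / (p - 1 - β)` the two sides scale alike on
`C |x|^γ`, and `C` is chosen to make the inequality true. The Hessian of `|x|^γ` is of size
`|x|^{γ-2}`, whence its Sobolev regularity.

If `c > 0`, a subsolution satisfies `div (|Du|^{p-2} Du) ≥ c₀ |x|^α |Du|^β e^{cu}` away from the
origin. Testing with `e^{su} φ^m` for a cutoff `φ` at scale `R` and absorbing the term containing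
`Dφ` by Young's inequality bounds `∫ |Du|^p e^{su} φ^m` by `M R^{-p}`, so `Du = 0`.
-/

section SymmetricFunctions

open Finset

variable {n k : ℕ} {lam : Fin n → ℝ} {t : ℝ}

/-- The two properties of an operator `F(λ)` on a cone `K` that the argument uses: in the positive
orthant `F` is at least the smallest eigenvalue, and on `K` it is at most a multiple of the
trace. -/
structure IsTraceComparable (K : Set (Fin n → ℝ)) (F : (Fin n → ℝ) → ℝ) : Prop where
  mem_and_le : ∀ lam t, 0 < t → (∀ i, t ≤ lam i) → lam ∈ K ∧ t ≤ F lam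
  exists_le_mul_sum : ∃ C, 0 < C ∧ ∀ lam ∈ K, F lam ≤ C * ∑ i, lam i

lemma sumOfProducts_eq_aeval_esymm (lam : Fin n → ℝ) :
    sumOfProducts k lam = MvPolynomial.aeval lam (MvPolynomial.esymm (Fin n) ℝ k) := by
  simp [sumOfProducts, MvPolynomial.esymm]

lemma sumOfProducts_one (lam : Fin n → ℝ) : sumOfProducts 1 lam = ∑ i, lam i := by
  simp [sumOfProducts, powersetCard_one]

lemma two_mul_sumOfProducts_two (lam : Fin n → ℝ) :
    2 * sumOfProducts 2 lam = (∑ i, lam i) ^ 2 - ∑ i, lam i ^ 2 := by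
  have newton := congrArg (MvPolynomial.aeval lam) (MvPolynomial.mul_esymm_eq_sum (Fin n) ℝ 2)
  have hpairs : ({a ∈ antidiagonal 2 | a.1 < 2} : Finset (ℕ × ℕ)) = {(0, 2), (1, 1)} := by decide
  rw [hpairs, sum_pair (by decide)] at newton
  simp only [MvPolynomial.psum, pow_one, map_mul, map_add, map_pow, map_neg, map_one, map_sum,
    map_natCast, MvPolynomial.aeval_X, ← sumOfProducts_eq_aeval_esymm, sumOfProducts_one] at newton
  rw [show sumOfProducts 0 lam = 1 by simp [sumOfProducts]] at newton
  push_cast at newton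
  linear_combination newton

lemma sum_pos_of_mem_gardingCone (hk : 1 ≤ k) (h : lam ∈ gardingCone n k) : 0 < ∑ i, lam i :=
  sumOfProducts_one lam ▸ h 1 le_rfl hk

lemma abs_le_sum_of_mem_gardingCone (hk : 2 ≤ k) (h : lam ∈ gardingCone n k) (i : Fin n) :
    |lam i| ≤ ∑ j, lam j := by
  have hS₂ : 0 < sumOfProducts 2 lam := h 2 one_le_two hk
  have hi : lam i ^ 2 ≤ ∑ j, lam j ^ 2 :=
    single_le_sum (f := fun j => lam j ^ 2) (fun j _ => sq_nonneg _) (mem_univ i)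
  refine abs_le_of_sq_le_sq ?_ (sum_pos_of_mem_gardingCone (by lia) h).le
  linarith [two_mul_sumOfProducts_two lam]

lemma sumOfProducts_le_of_mem_gardingCone (hk : 1 ≤ k) (hkn : k ≤ n)
    (h : lam ∈ gardingCone n k) : sumOfProducts k lam ≤ n.choose k * (∑ i, lam i) ^ k := by
  obtain rfl | hk₂ := hk.eq_or_lt
  · rw [sumOfProducts_one, pow_one, Nat.choose_one_right]
    exact le_mul_of_one_le_left (sum_pos_of_mem_gardingCone le_rfl h).le (mod_cast hkn)
  · calc sumOfProducts k lam
        ≤ ∑ _s ∈ powersetCard k (univ : Finset (Fin n)), (∑ j, lam j) ^ k := by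
          refine sum_le_sum fun s hs => ?_
          rw [← (mem_powersetCard.1 hs).2, ← prod_const]
          exact (le_abs_self _).trans <| (abs_prod s lam).trans_le <|
            prod_le_prod (fun _ _ => abs_nonneg _)
              fun i _ => abs_le_sum_of_mem_gardingCone hk₂ h i
      _ = n.choose k * (∑ j, lam j) ^ k := by simp

lemma sumOfProducts_rpow_le_of_mem_gardingCone (hk : 1 ≤ k) (hkn : k ≤ n)
    (h : lam ∈ gardingCone n k) :
    sumOfProducts k lam ^ (1 / (k : ℝ)) ≤ (n.choose k : ℝ) ^ (1 / (k : ℝ)) * ∑ i, lam i := by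
  have hS := (sum_pos_of_mem_gardingCone hk h).le
  calc sumOfProducts k lam ^ (1 / (k : ℝ))
      ≤ (n.choose k * (∑ i, lam i) ^ k) ^ (1 / (k : ℝ)) :=
        Real.rpow_le_rpow (h k hk le_rfl).le (sumOfProducts_le_of_mem_gardingCone hk hkn h)
          (by positivity)
    _ = (n.choose k : ℝ) ^ (1 / (k : ℝ)) * ∑ i, lam i := by
        rw [Real.mul_rpow (by positivity) (by positivity), one_div,
          Real.pow_rpow_inv_natCast hS (by lia)]

lemma pow_le_sumOfProducts (hkn : k ≤ n) (ht : 0 ≤ t) (h : ∀ i, t ≤ lam i) :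
    t ^ k ≤ sumOfProducts k lam := by
  obtain ⟨s, hs⟩ := powersetCard_nonempty.2 (show k ≤ #(univ : Finset (Fin n)) by simpa)
  calc t ^ k = ∏ _i ∈ s, t := by rw [prod_const, (mem_powersetCard.1 hs).2]
    _ ≤ ∏ i ∈ s, lam i := prod_le_prod (fun _ _ => ht) fun i _ => h i
    _ ≤ sumOfProducts k lam := single_le_sum (f := fun s => ∏ i ∈ s, lam i)
        (fun s _ => prod_nonneg fun i _ => ht.trans (h i)) hs

lemma le_rpow_one_div_of_pow_le {m : ℕ} {y : ℝ} (hm : m ≠ 0) (ht : 0 ≤ t) (h : t ^ m ≤ y) :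
    t ≤ y ^ (1 / (m : ℝ)) := by
  rwa [one_div, Real.le_rpow_inv_iff_of_pos ht ((pow_nonneg ht m).trans h)
    (by positivity), Real.rpow_natCast]

theorem isTraceComparable_sumOfProducts (hk : 1 ≤ k) (hkn : k ≤ n) :
    IsTraceComparable (gardingCone n k) (fun lam => sumOfProducts k lam ^ (1 / (k : ℝ))) where
  mem_and_le _ t ht h :=
    ⟨fun i _ hik => (pow_pos ht i).trans_le (pow_le_sumOfProducts (hik.trans hkn) ht.le h),
      le_rpow_one_div_of_pow_le (by lia) ht.le (pow_le_sumOfProducts hkn ht.le h)⟩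
  exists_le_mul_sum :=
    ⟨(n.choose k : ℝ) ^ (1 / (k : ℝ)),
      Real.rpow_pos_of_pos (mod_cast Nat.choose_pos hkn) _,
      fun _ h => sumOfProducts_rpow_le_of_mem_gardingCone hk hkn h⟩

lemma sum_powersetCard_sum {ι M : Type*} [AddCommMonoid M] (s : Finset ι) (hk : 1 ≤ k)
    (f : ι → M) :
    ∑ u ∈ powersetCard k s, ∑ i ∈ u, f i = (#s - 1).choose (k - 1) • ∑ i ∈ s, f i := by
  classical
  have hcount : ∀ i ∈ s, #{u ∈ powersetCard k s | i ∈ u} = (#s - 1).choose (k - 1) :=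
    fun i hi => by
      simpa using card_filter_powersetCard_subset {i} s k (by simpa using hi) (by simpa using hk)
  rw [sum_comm' (t' := s) (s' := fun i => {u ∈ powersetCard k s | i ∈ u}), smul_sum]
  · exact sum_congr rfl fun i hi => by rw [sum_const, hcount i hi]
  · intro u i
    simp only [mem_filter, mem_powersetCard]
    exact ⟨fun h => ⟨h, h.1.1 h.2⟩, fun h => h.1⟩

lemma productOfSums_rpow_le_of_mem_sumCone (hk : 1 ≤ k) (hkn : k ≤ n) (h : lam ∈ sumCone n k) :
    productOfSums k lam ^ (1 / (n.choose k : ℝ)) ≤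
      ((n - 1).choose (k - 1) / n.choose k : ℝ) * ∑ i, lam i := by
  have amgm := Real.geom_mean_le_arith_mean (powersetCard k univ) (fun _ => 1)
    (fun s => ∑ i ∈ s, lam i) (fun _ _ => zero_le_one)
    (by simpa using Nat.choose_pos hkn) fun s hs => (h s hs).le
  simp only [Real.rpow_one, one_mul, sum_powersetCard_sum univ hk, sum_const, card_powersetCard,
    card_univ, Fintype.card_fin, nsmul_eq_mul, mul_one] at amgm
  rwa [one_div, div_mul_eq_mul_div]

lemma le_sum_of_forall_le {s : Finset (Fin n)} (hs : s.Nonempty) (ht : 0 ≤ t)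
    (h : ∀ i, t ≤ lam i) : t ≤ ∑ i ∈ s, lam i := by
  obtain ⟨i, hi⟩ := hs
  exact (h i).trans (single_le_sum (fun j _ => ht.trans (h j)) hi)

theorem isTraceComparable_productOfSums (hk : 1 ≤ k) (hkn : k ≤ n) :
    IsTraceComparable (sumCone n k)
      (fun lam => productOfSums k lam ^ (1 / (n.choose k : ℝ))) where
  mem_and_le lam t ht h := by
    have hle : ∀ s ∈ powersetCard k (univ : Finset (Fin n)), t ≤ ∑ i ∈ s, lam i := fun s hs =>
      le_sum_of_forall_le (card_pos.1 ((mem_powersetCard.1 hs).2 ▸ hk)) ht.le h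
    refine ⟨fun s hs => ht.trans_le (hle s hs),
      le_rpow_one_div_of_pow_le (Nat.choose_pos hkn).ne' ht.le ?_⟩
    calc t ^ n.choose k = ∏ _s ∈ powersetCard k (univ : Finset (Fin n)), t := by simp
      _ ≤ productOfSums k lam := prod_le_prod (fun _ _ => ht.le) hle
  exists_le_mul_sum :=
    ⟨(n - 1).choose (k - 1) / n.choose k,
      div_pos (mod_cast Nat.choose_pos (by lia)) (mod_cast Nat.choose_pos hkn),
      fun _ h => productOfSums_rpow_le_of_mem_sumCone hk hkn h⟩

end SymmetricFunctions

section Eigenvalues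

variable {n : ℕ}

lemma IsEigenvalueVector.trace_eq_sum {A : RSpace n →L[ℝ] RSpace n} {lam : Fin n → ℝ}
    (h : IsEigenvalueVector A lam) : LinearMap.trace ℝ _ (A : RSpace n →ₗ[ℝ] RSpace n) =
      ∑ i, lam i := by
  have hsplits : (A : RSpace n →ₗ[ℝ] RSpace n).charpoly.Splits := by
    rw [h]
    exact .prod fun i _ => .X_sub_C _
  have hroots : (A : RSpace n →ₗ[ℝ] RSpace n).charpoly.roots = Finset.univ.val.map lam := by
    rw [h, ← Polynomial.roots_multiset_prod_X_sub_C (Finset.univ.val.map lam), Multiset.map_map]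
    rfl
  rw [Module.End.trace_eq_sum_roots_charpoly_of_splits hsplits, hroots]
  rfl

lemma charpoly_innerSL_smulRight (x y : RSpace (n + 1)) :
    ((innerSL ℝ x).smulRight y : RSpace (n + 1) →ₗ[ℝ] RSpace (n + 1)).charpoly =
      Polynomial.X ^ n * (Polynomial.X - Polynomial.C (inner ℝ x y)) := by
  have hmatrix : LinearMap.toMatrix (EuclideanSpace.basisFun (Fin (n + 1)) ℝ).toBasis
      (EuclideanSpace.basisFun (Fin (n + 1)) ℝ).toBasis
      ((innerSL ℝ x).smulRight y : RSpace (n + 1) →ₗ[ℝ] RSpace (n + 1)) =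
      Matrix.vecMulVec y x := by
    ext i j
    simp [LinearMap.toMatrix_apply, Matrix.vecMulVec_apply, EuclideanSpace.inner_single_right,
      mul_comm]
  rw [← LinearMap.charpoly_toMatrix _ (EuclideanSpace.basisFun (Fin (n + 1)) ℝ).toBasis, hmatrix,
    Matrix.charpoly_vecMulVec, EuclideanSpace.inner_eq_star_dotProduct]
  simp [Polynomial.smul_eq_C_mul]
  ring

lemma isEigenvalueVector_smul_id_add_smulRight (a : ℝ) (x y : RSpace (n + 1)) :
    IsEigenvalueVector (a • ContinuousLinearMap.id ℝ _ + (innerSL ℝ x).smulRight y)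
      (Function.update (fun _ => a) 0 (a + inner ℝ x y)) := by
  have hshift : ((a • ContinuousLinearMap.id ℝ _ + (innerSL ℝ x).smulRight y :
      RSpace (n + 1) →L[ℝ] RSpace (n + 1)) : RSpace (n + 1) →ₗ[ℝ] RSpace (n + 1)) =
      ((innerSL ℝ x).smulRight y : RSpace (n + 1) →ₗ[ℝ] RSpace (n + 1)) -
        (-a) • (1 : Module.End ℝ _) := by
    ext1 v
    simp [add_comm]
  rw [IsEigenvalueVector, hshift, LinearMap.charpoly_sub_smul, charpoly_innerSL_smulRight,
    Fin.prod_univ_succ]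
  simp
  ring

end Eigenvalues

section RadialField

lemma tendsto_norm_rpow_zero {E : Type*} [SeminormedAddCommGroup E] {σ : ℝ} (hσ : 0 < σ) :
    Filter.Tendsto (fun y : E => ‖y‖ ^ σ) (nhds 0) (nhds 0) := by
  simpa [ContinuousAt, hσ.ne'] using
    (continuousAt_id (x := (0 : E))).norm.rpow_const (p := σ) (.inr hσ.le)

variable {E : Type*} [NormedAddCommGroup E] [InnerProductSpace ℝ E] {σ : ℝ} {x : E}

/-- The derivative of the field `y ↦ ‖y‖ ^ σ • y`. Its junk value at the origin is `0` for
`0 < σ`, which is then the true derivative. -/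
noncomputable def radialDeriv (σ : ℝ) (x : E) : E →L[ℝ] E :=
  ‖x‖ ^ σ • ContinuousLinearMap.id ℝ E + (innerSL ℝ x).smulRight ((σ * ‖x‖ ^ (σ - 2)) • x)

lemma radialDeriv_zero (hσ : σ ≠ 0) : radialDeriv σ (0 : E) = 0 := by
  simp [radialDeriv, hσ]

lemma rpow_sub_two_mul_sq {r : ℝ} (hr : 0 < r) (σ : ℝ) : r ^ (σ - 2) * r ^ 2 = r ^ σ := by
  rw [← Real.rpow_natCast, ← Real.rpow_add hr]
  norm_num

lemma norm_radialDeriv_le (σ : ℝ) (x : E) : ‖radialDeriv σ x‖ ≤ (1 + |σ|) * ‖x‖ ^ σ := by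
  have hid : ‖‖x‖ ^ σ • ContinuousLinearMap.id ℝ E‖ ≤ ‖x‖ ^ σ := by
    rw [norm_smul, Real.norm_of_nonneg (by positivity)]
    exact mul_le_of_le_one_right (by positivity) ContinuousLinearMap.norm_id_le
  have hrank_one : ‖(innerSL ℝ x).smulRight ((σ * ‖x‖ ^ (σ - 2)) • x)‖ ≤ |σ| * ‖x‖ ^ σ := by
    rw [ContinuousLinearMap.norm_smulRight_apply, innerSL_apply_norm, norm_smul, norm_mul,
      Real.norm_of_nonneg (show 0 ≤ ‖x‖ ^ (σ - 2) by positivity), Real.norm_eq_abs]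
    obtain hx | hx := (norm_nonneg x).eq_or_lt
    · rw [← hx, zero_mul]
      positivity
    · rw [← rpow_sub_two_mul_sq hx σ]
      exact le_of_eq (by ring)
  rw [add_mul, one_mul]
  exact (norm_add_le _ _).trans (add_le_add hid hrank_one)

lemma hasFDerivAt_norm_rpow_of_ne (hx : x ≠ 0) (σ : ℝ) :
    HasFDerivAt (fun y : E => ‖y‖ ^ σ) ((σ * ‖x‖ ^ (σ - 2)) • innerSL ℝ x) x := by
  apply HasStrictFDerivAt.hasFDerivAt
  convert! (hasStrictFDerivAt_norm_sq x).rpow_const (p := σ / 2) (by simp [hx]) using 0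
  simp_rw [← Real.rpow_natCast_mul (norm_nonneg _), ← Nat.cast_smul_eq_nsmul ℝ, smul_smul]
  ring_nf

lemma hasFDerivAt_norm_rpow_smul_zero (hσ : 0 < σ) :
    HasFDerivAt (fun y : E => ‖y‖ ^ σ • y) (0 : E →L[ℝ] E) 0 := by
  refine .of_isLittleO ?_
  simpa using ((Asymptotics.isLittleO_one_iff ℝ).2 (tendsto_norm_rpow_zero (E := E) hσ)).smul_isBigO
    (Asymptotics.isBigO_refl (fun y : E => y) (nhds 0))

lemma hasFDerivAt_norm_rpow_smul (h : x ≠ 0 ∨ 0 < σ) :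
    HasFDerivAt (fun y : E => ‖y‖ ^ σ • y) (radialDeriv σ x) x := by
  obtain rfl | hx := eq_or_ne x 0
  · have hσ : 0 < σ := h.resolve_left (not_not.2 rfl)
    exact radialDeriv_zero (E := E) hσ.ne' ▸ hasFDerivAt_norm_rpow_smul_zero hσ
  · refine ((hasFDerivAt_norm_rpow_of_ne hx σ).smul (hasFDerivAt_id x)).congr_fderiv ?_
    ext v
    simp [radialDeriv, smul_smul, mul_comm]

lemma norm_norm_rpow_smul (hσ : σ + 1 ≠ 0) (x : E) : ‖‖x‖ ^ σ • x‖ = ‖x‖ ^ (σ + 1) := by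
  rw [norm_smul, Real.norm_of_nonneg (by positivity), Real.rpow_add_one' (norm_nonneg x) hσ]

lemma continuous_norm_rpow_smul (hσ : -1 < σ) : Continuous fun y : E => ‖y‖ ^ σ • y := by
  refine continuous_iff_continuousAt.2 fun x => ?_
  obtain rfl | hx := eq_or_ne x 0
  · rw [ContinuousAt, smul_zero, tendsto_zero_iff_norm_tendsto_zero]
    simp_rw [norm_norm_rpow_smul (show σ + 1 ≠ 0 by linarith)]
    exact tendsto_norm_rpow_zero (by linarith)
  · exact (hasFDerivAt_norm_rpow_smul (.inl hx)).continuousAt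

lemma continuousAt_radialDeriv (hx : x ≠ 0) : ContinuousAt (radialDeriv σ : E → E →L[ℝ] E) x := by
  have h : (radialDeriv σ : E → E →L[ℝ] E) = fun y => ‖y‖ ^ σ • ContinuousLinearMap.id ℝ E +
      ContinuousLinearMap.smulRightL ℝ E E (innerSL ℝ y) ((σ * ‖y‖ ^ (σ - 2)) • y) := rfl
  rw [h]
  fun_prop (discharger := simp [hx])

lemma continuous_radialDeriv (hσ : 0 < σ) : Continuous (radialDeriv σ : E → E →L[ℝ] E) := by
  refine continuous_iff_continuousAt.2 fun x => ?_
  obtain rfl | hx := eq_or_ne x 0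
  · rw [ContinuousAt, radialDeriv_zero hσ.ne']
    refine squeeze_zero_norm (norm_radialDeriv_le σ) ?_
    simpa using (tendsto_norm_rpow_zero (E := E) hσ).const_mul (1 + |σ|)
  · exact continuousAt_radialDeriv hx

lemma contDiff_norm_rpow_smul (hσ : 0 < σ) : ContDiff ℝ 1 fun y : E => ‖y‖ ^ σ • y :=
  contDiff_one_iff_hasFDerivAt.2 ⟨radialDeriv σ, continuous_radialDeriv hσ,
    fun _ => hasFDerivAt_norm_rpow_smul (.inr hσ)⟩

lemma contDiff_two_norm_rpow {γ : ℝ} (hγ : 2 ≤ γ) : ContDiff ℝ 2 fun y : E => ‖y‖ ^ γ := by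
  obtain rfl | hγ := hγ.eq_or_lt
  · simpa only [Real.rpow_ofNat] using contDiff_norm_sq ℝ
  · have hfderiv : fderiv ℝ (fun y : E => ‖y‖ ^ γ) =
        fun y => γ • innerSL ℝ (‖y‖ ^ (γ - 2) • y) := by
      ext1 y
      rw [fderiv_norm_rpow y (by linarith), map_smul, smul_smul]
    rw [← one_add_one_eq_two, contDiff_succ_iff_fderiv, hfderiv]
    exact ⟨differentiable_norm_rpow (by linarith), by simp,
      ((innerSL ℝ).contDiff.comp (contDiff_norm_rpow_smul (by linarith))).const_smul γ⟩

end RadialField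

section RadialSolution

variable {n : ℕ} {p α β γ C : ℝ}

/-- The radial function `C |x|^γ`. -/
noncomputable def radialPower (C γ : ℝ) (x : RSpace n) : ℝ := C * ‖x‖ ^ γ

lemma contDiff_radialPower (hγ : 1 < γ) : ContDiff ℝ 1 (radialPower C γ : RSpace n → ℝ) :=
  contDiff_const.mul (contDiff_norm_rpow hγ)

lemma contDiff_two_radialPower (hγ : 2 ≤ γ) : ContDiff ℝ 2 (radialPower C γ : RSpace n → ℝ) :=
  contDiff_const.mul (contDiff_two_norm_rpow hγ)

lemma contDiffOn_radialPower : ContDiffOn ℝ 2 (radialPower C γ : RSpace n → ℝ) {0}ᶜ :=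
  fun _ hx => (contDiffAt_const.mul ((contDiffAt_norm ℝ hx).rpow_const_of_ne
    (norm_ne_zero_iff.2 hx))).contDiffWithinAt

lemma gradient_radialPower (hγ : 1 < γ) (x : RSpace n) :
    gradient (radialPower C γ) x = (C * γ) • ‖x‖ ^ (γ - 2) • x := by
  refine HasGradientAt.gradient (hasGradientAt_iff_hasFDerivAt.2 ?_)
  refine ((hasFDerivAt_norm_rpow x hγ).const_mul C).congr_fderiv ?_
  ext v
  simp [mul_assoc]

lemma norm_gradient_radialPower (hγ : 1 < γ) (hC : 0 ≤ C) (x : RSpace n) :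
    ‖gradient (radialPower C γ) x‖ = C * γ * ‖x‖ ^ (γ - 1) := by
  rw [gradient_radialPower hγ, norm_smul, norm_norm_rpow_smul (by linarith),
    Real.norm_of_nonneg (by positivity)]
  ring_nf

lemma pGradient_radialPower (hγ : 1 < γ) (hC : 0 < C) (x : RSpace n) :
    pGradient p (radialPower C γ) x =
      (C * γ) ^ (p - 1) • ‖x‖ ^ ((γ - 1) * (p - 1) - 1) • x := by
  obtain rfl | hx := eq_or_ne x 0
  · simp [pGradient, gradient_radialPower hγ]
  have hnorm : 0 < ‖x‖ := norm_pos_iff.2 hx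
  have hCγ : 0 < C * γ := by positivity
  have hconst : (C * γ) ^ (p - 1) = (C * γ) ^ (p - 2) * (C * γ) := by
    rw [← Real.rpow_add_one hCγ.ne']
    ring_nf
  have hpow : ‖x‖ ^ ((γ - 1) * (p - 1) - 1) = ‖x‖ ^ ((γ - 1) * (p - 2)) * ‖x‖ ^ (γ - 2) := by
    rw [← Real.rpow_add hnorm]
    ring_nf
  rw [pGradient, norm_gradient_radialPower hγ hC.le, gradient_radialPower hγ,
    Real.mul_rpow hCγ.le (by positivity), ← Real.rpow_mul hnorm.le, hconst, hpow]
  simp only [smul_smul]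
  ring_nf

lemma hasFDerivAt_pGradient_radialPower (hγ : 1 < γ) (hC : 0 < C) {x : RSpace n} (hx : x ≠ 0) :
    HasFDerivAt (pGradient p (radialPower C γ))
      ((C * γ) ^ (p - 1) • radialDeriv ((γ - 1) * (p - 1) - 1) x) x := by
  rw [funext (pGradient_radialPower (p := p) hγ hC)]
  exact (hasFDerivAt_norm_rpow_smul (.inl hx)).const_smul ((C * γ) ^ (p - 1))

lemma isEigenvalueVector_smul_radialDeriv {x : RSpace (n + 1)} (hx : x ≠ 0) (c σ : ℝ) :
    IsEigenvalueVector (c • radialDeriv σ x)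
      (Function.update (fun _ => c * ‖x‖ ^ σ) 0 ((σ + 1) * (c * ‖x‖ ^ σ))) := by
  have hsmul : c • radialDeriv σ x = (c * ‖x‖ ^ σ) • ContinuousLinearMap.id ℝ _ +
      (innerSL ℝ x).smulRight (c • (σ * ‖x‖ ^ (σ - 2)) • x) := by
    ext1 v
    simp only [radialDeriv, smul_apply, add_apply,
      ContinuousLinearMap.smulRight_apply, smul_add, mul_smul, smul_comm c]
  have hradial : c * ‖x‖ ^ σ + inner ℝ x (c • (σ * ‖x‖ ^ (σ - 2)) • x) =
      (σ + 1) * (c * ‖x‖ ^ σ) := by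
    rw [inner_smul_right, inner_smul_right, real_inner_self_eq_norm_sq,
      ← rpow_sub_two_mul_sq (norm_pos_iff.2 hx) σ]
    ring
  exact hsmul ▸ hradial ▸ isEigenvalueVector_smul_id_add_smulRight _ _ _

lemma mul_le_update_mul {a m : ℝ} (ha : 0 ≤ a) (i : Fin (n + 1)) :
    min 1 m * a ≤ Function.update (fun _ => a) 0 (m * a) i := by
  obtain rfl | hi := eq_or_ne i 0
  · simpa using mul_le_mul_of_nonneg_right (min_le_right 1 m) ha
  · simpa [hi] using mul_le_of_le_one_left ha (min_le_left 1 m)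

lemma isAdmissibleSubsolution_radialPower {K : Set (Fin (n + 1) → ℝ)}
    {F : (Fin (n + 1) → ℝ) → ℝ} {f : ℝ → ℝ} (hK : IsTraceComparable K F) (hp : 1 < p)
    (hγ : 1 < γ) (hC : 0 < C) (hexponent : (γ - 1) * (p - 1 - β) = α + 1)
    (hconst : (C * γ) ^ (p - 1) * min 1 ((γ - 1) * (p - 1)) = (C * γ) ^ β)
    (hf : ∀ t, 0 ≤ t → f t ≤ 1) : IsAdmissibleSubsolution K F p α β f (radialPower C γ) := by
  refine ⟨⟨EuclideanSpace.single 0 1, 0, ?_⟩, fun x hx => ?_⟩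
  · simp [radialPower, Real.zero_rpow (show γ ≠ 0 by linarith), hC.ne']
  set m := (γ - 1) * (p - 1)
  set a := (C * γ) ^ (p - 1) * ‖x‖ ^ (m - 1) with ha
  have hnorm : 0 < ‖x‖ := norm_pos_iff.2 hx
  have ha_pos : 0 < a := by positivity
  have hderiv := hasFDerivAt_pGradient_radialPower (p := p) hγ hC hx
  have heigen := isEigenvalueVector_smul_radialDeriv hx ((C * γ) ^ (p - 1)) (m - 1)
  rw [sub_add_cancel] at heigen
  obtain ⟨hmem, hle⟩ := hK.mem_and_le _ (min 1 m * a) (by positivity)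
    (mul_le_update_mul ha_pos.le)
  refine ⟨hderiv.differentiableAt, fun _ => ?_, _, hderiv.fderiv ▸ heigen, hmem, le_trans ?_ hle⟩
  · rw [← norm_pos_iff, norm_gradient_radialPower hγ hC.le]
    positivity
  · have hpow : ‖x‖ ^ (m - 1) = ‖x‖ ^ α * ‖x‖ ^ ((γ - 1) * β) := by
      rw [← Real.rpow_add hnorm]
      congr 1
      linarith
    have hweight : ‖x‖ ^ α * ‖gradient (radialPower C γ) x‖ ^ β = min 1 m * a := by
      rw [norm_gradient_radialPower hγ hC.le, Real.mul_rpow (by positivity) (by positivity),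
        ← Real.rpow_mul hnorm.le, ← hconst, ha, hpow]
      ring
    rw [hweight]
    exact mul_le_of_le_one_right (by positivity) (hf _ (by unfold radialPower; positivity))

/-- The exponent `γ` for which the two sides of the equation with `f = 1` scale alike on
`|x|^γ`. -/
noncomputable def radialExponent (p α β : ℝ) : ℝ := 1 + (α + 1) / (p - 1 - β)

lemma one_lt_radialExponent (hα : -1 < α) (hβ : β < p - 1) : 1 < radialExponent p α β :=
  lt_add_of_pos_right 1 (div_pos (by linarith) (by linarith))

lemma two_le_radialExponent (hβ : β < p - 1) (h : p ≤ α + β + 2) : 2 ≤ radialExponent p α β := by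
  have : 1 ≤ (α + 1) / (p - 1 - β) := (one_le_div (by linarith)).2 (by linarith)
  unfold radialExponent
  linarith

lemma neg_one_lt_radialExponent_sub_two_mul {δ : ℝ} (hβ : β < p - 1) (h : α + β + 2 < p)
    (hδ : δ < (p - β - 1) / (p - α - β - 2)) : -1 < (radialExponent p α β - 2) * δ := by
  have hβ' : p - 1 - β ≠ 0 := by linarith
  have hmul : δ * (p - α - β - 2) < p - β - 1 := (lt_div_iff₀ (by linarith)).1 hδ
  rw [radialExponent, show (1 + (α + 1) / (p - 1 - β) - 2) * δ =
    -(δ * (p - α - β - 2)) / (p - 1 - β) by field_simp; ring, lt_div_iff₀ (by linarith)]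
  linarith

lemma exists_pos_rpow_mul_eq_rpow {q b θ : ℝ} (hbq : b < q) (hθ : 0 < θ) :
    ∃ L, 0 < L ∧ L ^ q * θ = L ^ b := by
  refine ⟨θ ^ (-(q - b)⁻¹), by positivity, ?_⟩
  have hqb : q - b ≠ 0 := by linarith
  rw [← Real.rpow_mul hθ.le, ← Real.rpow_mul hθ.le, ← Real.rpow_add_one hθ.ne']
  congr 1
  field_simp
  ring

theorem exists_isAdmissibleSubsolution_radialPower {K : Set (Fin (n + 1) → ℝ)}
    {F : (Fin (n + 1) → ℝ) → ℝ} {f : ℝ → ℝ} (hK : IsTraceComparable K F) (hp : 1 < p)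
    (hα : -1 < α) (hβ : β < p - 1) (hf : ∀ t, 0 ≤ t → f t ≤ 1) :
    ∃ C, IsAdmissibleSubsolution K F p α β f (radialPower C (radialExponent p α β)) := by
  have hγ := one_lt_radialExponent hα hβ
  set γ := radialExponent p α β with hγ_def
  obtain ⟨L, hL, hLβ⟩ := exists_pos_rpow_mul_eq_rpow hβ
    (lt_min one_pos (mul_pos (sub_pos.2 hγ) (sub_pos.2 hp)))
  have hLγ : L / γ * γ = L := div_mul_cancel₀ _ (by linarith)
  refine ⟨L / γ, isAdmissibleSubsolution_radialPower hK hp hγ (by positivity) ?_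
    (by rwa [hLγ]) hf⟩
  rw [hγ_def, radialExponent, add_sub_cancel_left, div_mul_cancel₀ _ (by linarith)]

end RadialSolution

section DivergenceTheorem

open MeasureTheory Set

variable {n : ℕ}

lemma lt_norm_toLp_of_notMem_Icc {ρ : ℝ} {y : Fin n → ℝ}
    (hy : y ∉ Icc (fun _ => -ρ) (fun _ => ρ)) : ρ < ‖(WithLp.toLp 2 y : RSpace n)‖ := by
  by_contra! h
  have hcoord : ∀ i, |y i| ≤ ρ := fun i =>
    (PiLp.norm_apply_le (WithLp.toLp 2 y : RSpace n) i).trans h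
  exact hy ⟨fun i => (abs_le.1 (hcoord i)).1, fun i => (abs_le.1 (hcoord i)).2⟩

lemma integral_eq_setIntegral_Icc {ρ : ℝ} {G : RSpace n → ℝ} (hG : ∀ x, ρ < ‖x‖ → G x = 0) :
    ∫ x, G x = ∫ y in Icc (fun _ => -ρ) (fun _ => ρ), G (WithLp.toLp 2 y) := by
  rw [setIntegral_eq_integral_of_forall_compl_eq_zero
    fun y hy => hG _ (lt_norm_toLp_of_notMem_Icc hy)]
  exact ((PiLp.volume_preserving_toLp (Fin n)).integral_comp
    (MeasurableEquiv.toLp 2 (Fin n → ℝ)).measurableEmbedding G).symm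

lemma le_norm_toLp_insertNth (i : Fin (n + 1)) {t ρ : ℝ} (ht : ρ ≤ |t|) (y : Fin n → ℝ) :
    ρ ≤ ‖(WithLp.toLp 2 (i.insertNth t y : Fin (n + 1) → ℝ) : RSpace (n + 1))‖ := by
  refine ht.trans ?_
  simpa using PiLp.norm_apply_le
    (WithLp.toLp 2 (i.insertNth t y : Fin (n + 1) → ℝ) : RSpace (n + 1)) i

lemma setIntegral_le_of_hasIntegral {ι : Type} [Fintype ι] {I : BoxIntegral.Box ι}
    {l : BoxIntegral.IntegrationParams} {f g : (ι → ℝ) → ℝ} {c : ℝ}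
    (hf : BoxIntegral.HasIntegral I l f BoxIntegral.BoxAdditiveMap.volume c)
    (hg : Continuous g) (hgf : ∀ x ∈ BoxIntegral.Box.Icc I, g x ≤ f x) :
    ∫ x in BoxIntegral.Box.Icc I, g x ≤ c := by
  have hg_int := ContinuousOn.hasBoxIntegral (I := I) volume hg.continuousOn l
  rw [setIntegral_congr_set (BoxIntegral.Box.coe_ae_eq_Icc I)] at hg_int
  have hdiff := BoxIntegral.integral_nonneg (I := I) (l := l) (g := f - g)
    (fun x hx => sub_nonneg.2 (hgf x hx)) volume
  exact sub_nonneg.1 (hdiff.trans_eq (hf.sub hg_int).integral_eq)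

/-- The integral here is a gauge integral, for which the divergence theorem does not need the
divergence to be Lebesgue integrable. -/
lemma setIntegral_nonpos_of_le_divergence {I : BoxIntegral.Box (Fin (n + 1))}
    {f : (Fin (n + 1) → ℝ) → Fin (n + 1) → ℝ}
    {f' : (Fin (n + 1) → ℝ) → (Fin (n + 1) → ℝ) →L[ℝ] (Fin (n + 1) → ℝ)}
    {s : Set (Fin (n + 1) → ℝ)} {g : (Fin (n + 1) → ℝ) → ℝ} (hs : s.Countable)
    (hf : Continuous f) (hf' : ∀ y ∉ s, HasFDerivAt f (f' y) y)
    (hupper : ∀ i z, f (i.insertNth (I.upper i) z) i = 0)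
    (hlower : ∀ i z, f (i.insertNth (I.lower i) z) i = 0)
    (hg : Continuous g) (hle : ∀ y ∉ s, g y ≤ ∑ i, f' y (Pi.single i 1) i) :
    ∫ y in BoxIntegral.Box.Icc I, g y ≤ 0 := by
  classical
  -- On `s` the divergence is irrelevant, so `f'` is replaced there by a map of large trace.
  let A : (Fin (n + 1) → ℝ) → (Fin (n + 1) → ℝ) →L[ℝ] (Fin (n + 1) → ℝ) := fun y =>
    if y ∈ s then |g y| • ContinuousLinearMap.id ℝ _ else f' y
  have hA : ∀ y ∉ s, HasFDerivAt f (A y) y := fun y hy => by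
    simpa only [A, if_neg hy] using hf' y hy
  have htheorem := BoxIntegral.hasIntegral_GP_divergence_of_forall_hasDerivWithinAt I f A s hs
    (fun y _ => hf.continuousWithinAt) fun y hy => (hA y hy.2).hasFDerivWithinAt
  simp only [hupper, hlower, sub_self, Finset.sum_const_zero] at htheorem
  refine setIntegral_le_of_hasIntegral htheorem hg fun y _ => ?_
  by_cases hy : y ∈ s
  · calc g y ≤ |g y| := le_abs_self _
      _ ≤ (n + 1) * |g y| := le_mul_of_one_le_left (abs_nonneg _) (by simp)
      _ = ∑ i, A y (Pi.single i 1) i := by simp [A, hy]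
  · simpa only [A, if_neg hy] using hle y hy

/-- The divergence of a vector field on `ℝⁿ`, as the trace of its derivative. -/
noncomputable def divergence (V : RSpace n → RSpace n) (x : RSpace n) : ℝ :=
  LinearMap.trace ℝ (RSpace n) (fderiv ℝ V x)

lemma divergence_eq_sum (V : RSpace n → RSpace n) (x : RSpace n) :
    divergence V x = ∑ i, fderiv ℝ V x (EuclideanSpace.single i 1) i := by
  rw [divergence, LinearMap.trace_eq_sum_inner _ (EuclideanSpace.basisFun (Fin n) ℝ)]
  simp [EuclideanSpace.inner_single_left]

lemma divergence_smul {ψ : RSpace n → ℝ} {V : RSpace n → RSpace n} {x : RSpace n}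
    (hψ : DifferentiableAt ℝ ψ x) (hV : DifferentiableAt ℝ V x) :
    divergence (fun y => ψ y • V y) x = ψ x * divergence V x + fderiv ℝ ψ x (V x) := by
  rw [divergence, fderiv_fun_smul hψ hV, divergence]
  simp

theorem integral_le_of_sub_le_divergence {V : RSpace (n + 1) → RSpace (n + 1)}
    {s : Set (RSpace (n + 1))} {G : RSpace (n + 1) → ℝ} {ρ E : ℝ} (hs : s.Countable)
    (hρ : 0 < ρ) (hV : Continuous V) (hV' : ∀ x ∉ s, DifferentiableAt ℝ V x)
    (hV₀ : ∀ x, ρ ≤ ‖x‖ → V x = 0) (hG : Continuous G) (hG₀ : ∀ x, ρ ≤ ‖x‖ → G x = 0)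
    (hle : ∀ x ∉ s, G x - E ≤ divergence V x) : ∫ x, G x ≤ E * (2 * ρ) ^ (n + 1) := by
  let e : RSpace (n + 1) ≃L[ℝ] (Fin (n + 1) → ℝ) :=
    PiLp.continuousLinearEquiv 2 ℝ fun _ : Fin (n + 1) => ℝ
  let I : BoxIntegral.Box (Fin (n + 1)) := ⟨fun _ => -ρ, fun _ => ρ, fun _ => by simpa using hρ⟩
  have hG_box : Continuous fun y => G (e.symm y) := hG.comp e.symm.continuous
  have hface : ∀ i t, ρ ≤ |t| → ∀ z : Fin n → ℝ, e (V (e.symm (i.insertNth t z))) i = 0 :=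
    fun i t ht z => congrFun (congrArg e (hV₀ _ (le_norm_toLp_insertNth i ht z))) i
  have hbox : ∫ y in BoxIntegral.Box.Icc I, (G (e.symm y) - E) ≤ 0 := by
    refine setIntegral_nonpos_of_le_divergence (s := e '' s) (f := fun y => e (V (e.symm y)))
      (f' := fun y => (e : RSpace (n + 1) →L[ℝ] _) ∘L fderiv ℝ V (e.symm y) ∘L
        (e.symm : _ →L[ℝ] RSpace (n + 1)))
      (hs.image e) (e.continuous.comp (hV.comp e.symm.continuous)) (fun y hy => ?_)
      (fun i => hface i _ (le_abs_self ρ)) (fun i => hface i _ ((le_abs_self ρ).trans_eq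
        (abs_neg ρ).symm)) (hG_box.sub continuous_const) fun y hy => ?_
    all_goals
      have hy' : e.symm y ∉ s := fun h => hy ⟨_, h, e.apply_symm_apply y⟩
    · exact e.hasFDerivAt.comp y ((hV' _ hy').hasFDerivAt.comp y e.symm.hasFDerivAt)
    · exact (hle _ hy').trans_eq (divergence_eq_sum V _)
  have hvolume : (volume : Measure (Fin (n + 1) → ℝ)).real (Icc (fun _ => -ρ) fun _ => ρ) =
      (2 * ρ) ^ (n + 1) := by
    rw [measureReal_def, Real.volume_Icc_pi_toReal fun _ => by linarith]
    simp [two_mul]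
  rw [show BoxIntegral.Box.Icc I = Icc (fun _ => -ρ) (fun _ => ρ) from rfl,
    integral_sub hG_box.continuousOn.integrableOn_Icc continuousOn_const.integrableOn_Icc,
    setIntegral_const, hvolume, smul_eq_mul, sub_nonpos, mul_comm] at hbox
  exact (integral_eq_setIntegral_Icc fun x hx => hG₀ x hx.le).trans_le hbox

end DivergenceTheorem

section WeakDerivative

open MeasureTheory

variable {n : ℕ} {s : Set (RSpace (n + 1))}

lemma sum_smulRight_single_apply {ι : Type*} [Fintype ι] [DecidableEq ι]
    (L : (ι → ℝ) →L[ℝ] ℝ) (j : ι) :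
    ∑ i, L.smulRight (Pi.single j 1 : ι → ℝ) (Pi.single i 1) i = L (Pi.single j 1) := by
  rw [Finset.sum_eq_single j (fun i _ hij => by simp [hij.symm]) (by simp)]
  simp

lemma integral_fderiv_single_eq_zero {v : RSpace (n + 1) → ℝ} (hs : s.Countable)
    (hv : Continuous v) (hv' : ∀ x ∉ s, DifferentiableAt ℝ v x) (hsupp : HasCompactSupport v)
    (j : Fin (n + 1)) (hint : Integrable fun x => fderiv ℝ v x (EuclideanSpace.single j 1)) :
    ∫ x, fderiv ℝ v x (EuclideanSpace.single j 1) = 0 := by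
  obtain ⟨ρ, hρ, hv₀⟩ := hsupp.exists_pos_le_norm
  have hfderiv₀ : ∀ x, ρ < ‖x‖ → fderiv ℝ v x (EuclideanSpace.single j 1) = 0 := fun x hx => by
    have hlocal : v =ᶠ[nhds x] fun _ => 0 := by
      filter_upwards [continuous_norm.continuousAt.eventually (lt_mem_nhds hx)] with y hy
      exact hv₀ y (le_of_lt hy)
    simp [hlocal.fderiv_eq]
  let e : RSpace (n + 1) ≃L[ℝ] (Fin (n + 1) → ℝ) :=
    PiLp.continuousLinearEquiv 2 ℝ fun _ : Fin (n + 1) => ℝ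
  have hface : ∀ (i : Fin (n + 1)) (t : ℝ), ρ ≤ |t| → ∀ z : Fin n → ℝ,
      v (e.symm (i.insertNth t z)) = 0 :=
    fun i t ht z => hv₀ _ (le_norm_toLp_insertNth i ht z)
  have hdiv : ∀ y : Fin (n + 1) → ℝ, ∑ i, (((fderiv ℝ v (e.symm y)) ∘L
      (e.symm : (Fin (n + 1) → ℝ) →L[ℝ] RSpace (n + 1))).smulRight
        (Pi.single j (1 : ℝ) : Fin (n + 1) → ℝ)) (Pi.single i 1) i =
      fderiv ℝ v (e.symm y) (EuclideanSpace.single j 1) :=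
    fun _ => sum_smulRight_single_apply _ j
  have hint_box : Integrable fun y : Fin (n + 1) → ℝ =>
      fderiv ℝ v (e.symm y) (EuclideanSpace.single j 1) :=
    ((PiLp.volume_preserving_toLp (Fin (n + 1))).integrable_comp_emb
      (MeasurableEquiv.toLp 2 (Fin (n + 1) → ℝ)).measurableEmbedding).2 hint
  have htheorem := integral_divergence_of_hasFDerivAt_off_countable (fun _ => -ρ) (fun _ => ρ)
    (fun _ => by linarith) (fun y => v (e.symm y) • (Pi.single j (1 : ℝ) : Fin (n + 1) → ℝ))
    _ (e '' s) (hs.image e) ((hv.comp e.symm.continuous).smul continuous_const).continuousOn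
    (fun y hy => ((hv' (e.symm y) fun h => hy.2 ⟨_, h, e.apply_symm_apply y⟩).hasFDerivAt.comp y
      e.symm.hasFDerivAt).smul_const _) (by simpa only [hdiv] using hint_box.integrableOn)
  rw [integral_eq_setIntegral_Icc hfderiv₀]
  simp only [hdiv] at htheorem
  refine htheorem.trans (Finset.sum_eq_zero fun i _ => ?_)
  simp [hface i ρ (le_abs_self ρ), hface i (-ρ) ((le_abs_self ρ).trans_eq (abs_neg ρ).symm)]

theorem isWeakPartial_fderiv {f : RSpace (n + 1) → ℝ} (hs : s.Countable) (hf : Continuous f)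
    (hf' : ∀ x ∉ s, DifferentiableAt ℝ f x) (j : Fin (n + 1))
    (hint : LocallyIntegrable fun x => fderiv ℝ f x (EuclideanSpace.single j 1)) :
    IsWeakPartial j f fun x => fderiv ℝ f x (EuclideanSpace.single j 1) := by
  intro φ hφ hsupp
  have hφ' : Differentiable ℝ φ := hφ.differentiable (by simp)
  have hleft : Integrable fun x => f x * fderiv ℝ φ x (EuclideanSpace.single j 1) :=
    (hf.mul ((hφ.continuous_fderiv (by simp)).clm_apply
      continuous_const)).integrable_of_hasCompactSupport (hsupp.fderiv_apply (𝕜 := ℝ) _).mul_left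
  have hright : Integrable fun x => fderiv ℝ f x (EuclideanSpace.single j 1) * φ x := by
    simpa only [smul_eq_mul] using
      hint.integrable_smul_right_of_hasCompactSupport hφ.continuous hsupp
  have hproduct : (fun x => fderiv ℝ (fun y => f y * φ y) x (EuclideanSpace.single j 1)) =ᵐ[volume]
      fun x => f x * fderiv ℝ φ x (EuclideanSpace.single j 1) +
        fderiv ℝ f x (EuclideanSpace.single j 1) * φ x := by
    filter_upwards [hs.ae_notMem volume] with x hx
    simp [fderiv_fun_mul (hf' x hx) (hφ' x), mul_comm]
  have hzero := integral_fderiv_single_eq_zero (v := fun x => f x * φ x) hs (hf.mul hφ.continuous)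
    (fun x hx => (hf' x hx).mul (hφ' x)) hsupp.mul_left j ((hleft.add hright).congr hproduct.symm)
  rw [integral_congr_ae hproduct, integral_add hleft hright] at hzero
  exact eq_neg_of_add_eq_zero_left hzero

end WeakDerivative

section Sobolev

open MeasureTheory

variable {n : ℕ} {δ : ℝ}

lemma memLpLocal_of_abs_le_rpow {f : RSpace (n + 1) → ℝ} {σ B : ℝ} (hf : Measurable f)
    (hδ : 0 < δ) (hσ : -(n + 1) < σ * δ) (hle : ∀ᵐ x, |f x| ≤ B * ‖x‖ ^ σ) :
    MemLpLocal δ f := by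
  intro K hK
  rw [← integrable_norm_rpow_iff hf.aestronglyMeasurable (by simpa using hδ)
    ENNReal.ofReal_ne_top, ENNReal.toReal_ofReal hδ.le]
  refine locallyIntegrable_iff.1 (locallyIntegrable_of_norm_le_rpow (C := |B| ^ δ)
    (α := -(σ * δ)) (by simp) (by simp; linarith) ?_
    (hf.norm.pow_const δ).aestronglyMeasurable) K hK
  filter_upwards [hle] with x hx
  calc ‖‖f x‖ ^ δ‖ = |f x| ^ δ := Real.norm_of_nonneg (by positivity)
    _ ≤ (|B| * ‖x‖ ^ σ) ^ δ := by
        gcongr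
        exact hx.trans (by gcongr; exact le_abs_self B)
    _ = |B| ^ δ * ‖x‖ ^ (- -(σ * δ)) := by
        rw [Real.mul_rpow (abs_nonneg B) (by positivity), ← Real.rpow_mul (norm_nonneg x), neg_neg]

lemma memLpLocal_of_continuous {n : ℕ} {f : RSpace n → ℝ} (hf : Continuous f) (δ : ℝ) :
    MemLpLocal δ f := by
  intro K hK
  obtain ⟨B, hB⟩ := hK.exists_bound_of_continuousOn hf.continuousOn
  have : IsFiniteMeasure (volume.restrict K) := ⟨by simpa using hK.measure_lt_top⟩
  exact MemLp.of_bound hf.aestronglyMeasurable B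
    ((ae_restrict_iff' hK.measurableSet).2 (ae_of_all _ hB))

lemma MemLpLocal.locallyIntegrable {n : ℕ} {f : RSpace n → ℝ} (hδ : 1 ≤ δ)
    (hf : MemLpLocal δ f) : LocallyIntegrable f := by
  refine locallyIntegrable_iff.2 fun K hK => ?_
  have : IsFiniteMeasure (volume.restrict K) := ⟨by simpa using hK.measure_lt_top⟩
  exact (hf K hK).integrable (by simpa using ENNReal.ofReal_le_ofReal hδ)

lemma fderiv_radialPower_single {C γ : ℝ} (hγ : 1 < γ) (i : Fin n) (x : RSpace n) :
    fderiv ℝ (radialPower C γ) x (EuclideanSpace.single i 1) =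
      C * γ * (‖x‖ ^ (γ - 2) • x) i := by
  rw [← inner_gradient_left, gradient_radialPower hγ]
  simp [EuclideanSpace.inner_single_right]

theorem memSobolevTwoLocal_radialPower {C γ : ℝ} (hγ : 1 < γ) (hδ : 1 ≤ δ)
    (hγδ : -1 < (γ - 2) * δ) :
    MemSobolevTwoLocal δ (radialPower C γ : RSpace (n + 1) → ℝ) := by
  set u : RSpace (n + 1) → ℝ := radialPower C γ
  let g (i : Fin (n + 1)) (x : RSpace (n + 1)) : ℝ := fderiv ℝ u x (EuclideanSpace.single i 1)
  have hu : ContDiff ℝ 1 u := contDiff_radialPower hγ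
  have hg : ∀ i, Continuous (g i) := fun i =>
    (hu.continuous_fderiv one_ne_zero).clm_apply continuous_const
  have hg' : ∀ i x, x ≠ 0 → HasFDerivAt (g i)
      ((C * γ) • (EuclideanSpace.proj i ∘L radialDeriv (γ - 2) x)) x := fun i x hx => by
    rw [show g i = _ from funext (fderiv_radialPower_single hγ i)]
    exact ((EuclideanSpace.proj (𝕜 := ℝ) i).hasFDerivAt.comp x
      (hasFDerivAt_norm_rpow_smul (.inl hx))).const_mul (C * γ)
  have hsecond : ∀ i j, MemLpLocal δ fun x => fderiv ℝ (g i) x (EuclideanSpace.single j 1) :=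
    fun i j => by
      refine memLpLocal_of_abs_le_rpow (σ := γ - 2) (B := |C * γ| * (1 + |γ - 2|))
        (measurable_fderiv_apply_const ℝ _ _) (by linarith)
        (by linarith [(n.cast_nonneg : (0 : ℝ) ≤ n)]) ?_
      filter_upwards [(Set.countable_singleton 0).ae_notMem volume] with x hx
      calc |fderiv ℝ (g i) x (EuclideanSpace.single j 1)|
          = |C * γ| * |radialDeriv (γ - 2) x (EuclideanSpace.single j 1) i| := by
            simp [(hg' i x hx).fderiv, abs_mul]
        _ ≤ |C * γ| * ((1 + |γ - 2|) * ‖x‖ ^ (γ - 2)) := by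
            gcongr
            refine (PiLp.norm_apply_le
              (radialDeriv (γ - 2) x (EuclideanSpace.single j 1)) i).trans ?_
            simpa using (radialDeriv (γ - 2) x).le_of_opNorm_le (norm_radialDeriv_le (γ - 2) x)
              (EuclideanSpace.single j 1)
        _ = _ := (mul_assoc ..).symm
  exact ⟨memLpLocal_of_continuous hu.continuous δ, g, _,
    fun i => ⟨memLpLocal_of_continuous (hg i) δ, isWeakPartial_fderiv Set.countable_empty
      hu.continuous (fun x _ => hu.differentiable one_ne_zero x) i (hg i).locallyIntegrable⟩,
    fun i j => ⟨hsecond i j, isWeakPartial_fderiv (Set.countable_singleton 0) (hg i)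
      (fun x hx => (hg' i x hx).differentiableAt) j ((hsecond i j).locallyIntegrable hδ)⟩⟩

end Sobolev

section Absorption

variable {n : ℕ} {d p α β c : ℝ}

lemma exists_rpow_mul_rpow_mul_le {a b e μ ν : ℝ} (ha : 0 < a) (hb : 0 < b) (he : 0 < e)
    (habe : a + b + e = 1) (hμ : 0 < μ) (hν : 0 < ν) :
    ∃ M, 0 ≤ M ∧ ∀ A B Q : ℝ, 0 ≤ A → 0 ≤ B → 0 ≤ Q →
      A ^ a * B ^ b * Q ≤ μ * A + ν * B + M * Q ^ (1 / e) := by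
  set κ := (μ / a) ^ a * (ν / b) ^ b with hκ
  have hκ_pos : 0 < κ := by positivity
  refine ⟨e * κ⁻¹ ^ (1 / e), by positivity, fun A B Q hA hB hQ => ?_⟩
  calc A ^ a * B ^ b * Q
      = (μ / a * A) ^ a * (ν / b * B) ^ b * ((κ⁻¹ * Q) ^ (1 / e)) ^ e := by
        rw [Real.mul_rpow (by positivity) hA, Real.mul_rpow (by positivity) hB,
          ← Real.rpow_mul (by positivity), one_div_mul_cancel he.ne', Real.rpow_one]
        field_simp
        rw [hκ]
        ring
    _ ≤ a * (μ / a * A) + b * (ν / b * B) + e * (κ⁻¹ * Q) ^ (1 / e) :=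
        Real.geom_mean_le_arith_mean3_weighted ha.le hb.le he.le (by positivity) (by positivity)
          (by positivity) habe
    _ = μ * A + ν * B + e * κ⁻¹ ^ (1 / e) * Q ^ (1 / e) := by
        rw [Real.mul_rpow (by positivity) hQ]
        field_simp

/-- Exponents for testing `div (|Du|^{p-2} Du) ≥ |x|^α |Du|^β e^{cu}` with `w = e^{su} φ^{1/e}` for
a cutoff function `φ` on `ℝᵈ`. Young's inequality with exponents `1/a`, `1/b` and `1/e` bounds the
term containing `Dφ` by `w |x|^α |Du|^β e^{cu}`, `w |Du|^p` and a remainder; `gradient_balance` and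
`height_balance` match the powers of `|Du|` and `e^u`, and `scaling` makes the remainder of size
`R^{-d-p}` at scale `R`. -/
structure AbsorptionExponents (d p α β c : ℝ) where
  a : ℝ
  b : ℝ
  e : ℝ
  s : ℝ
  a_pos : 0 < a
  b_pos : 0 < b
  e_pos : 0 < e
  s_pos : 0 < s
  add_eq_one : a + b + e = 1
  gradient_balance : β * a + p * b = p - 1
  height_balance : c * a = s * e
  scaling : α * a + 1 = e * (d + p)

lemma nonempty_absorptionExponents (hd : 0 < d) (hp : 1 < p) (hα : -1 < α) (hβ : β < p - 1)
    (hc : 0 < c) : Nonempty (AbsorptionExponents d p α β c) := by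
  obtain ⟨t, ht, htd⟩ : ∃ t, 0 < t ∧ t * d = α + p - β :=
    ⟨(α + p - β) / d, div_pos (by linarith) hd, div_mul_cancel₀ _ hd.ne'⟩
  have hpt : 0 < (p - 1) * t := mul_pos (by linarith) ht
  obtain ⟨a, ha, hat⟩ : ∃ a, 0 < a ∧ a * (p - β + p * t) = 1 := by
    have : 0 < p - β + p * t := by linarith
    exact ⟨(p - β + p * t)⁻¹, inv_pos.2 this, inv_mul_cancel₀ this.ne'⟩
  exact ⟨{
    a := a
    b := a * (p - 1 - β + (p - 1) * t)
    e := a * t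
    s := c / t
    a_pos := ha
    b_pos := mul_pos ha (by linarith)
    e_pos := mul_pos ha ht
    s_pos := div_pos hc ht
    add_eq_one := by linear_combination hat
    gradient_balance := by linear_combination (p - 1) * hat
    height_balance := by field_simp
    scaling := by linear_combination -hat - a * htd }⟩

namespace AbsorptionExponents

lemma one_le_one_div_e (X : AbsorptionExponents d p α β c) : 1 ≤ 1 / X.e :=
  one_le_one_div X.e_pos (by linarith [X.a_pos, X.b_pos, X.add_eq_one])

lemma rpow_mul_rpow (X : AbsorptionExponents d p α β c) (hp : 1 < p) {r G φ : ℝ} (hr : 0 ≤ r)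
    (hG : 0 ≤ G) (hφ : 0 ≤ φ) (t : ℝ) :
    (r ^ α * G ^ β * Real.exp (c * t) * (Real.exp (X.s * t) * φ ^ (1 / X.e))) ^ X.a *
      (G ^ p * (Real.exp (X.s * t) * φ ^ (1 / X.e))) ^ X.b =
    r ^ (α * X.a) * G ^ (p - 1) * (Real.exp (X.s * t) * φ ^ (1 / X.e - 1)) := by
  have he : X.a + X.b = 1 - X.e := by linarith [X.add_eq_one]
  have hab : X.a + X.b ≠ 0 := (add_pos X.a_pos X.b_pos).ne'
  have hgradient : G ^ (β * X.a) * G ^ (p * X.b) = G ^ (p - 1) := by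
    rw [← X.gradient_balance, Real.rpow_add' hG (by rw [X.gradient_balance]; linarith)]
  have hheight : Real.exp (c * t * X.a) * Real.exp (X.s * t * (X.a + X.b)) =
      Real.exp (X.s * t) := by
    rw [← Real.exp_add, he]
    congr 1
    linear_combination t * X.height_balance
  have hcutoff : φ ^ (1 / X.e * (X.a + X.b)) = φ ^ (1 / X.e - 1) := by
    rw [he, mul_sub, one_div_mul_cancel X.e_pos.ne', mul_one]
  calc _ = r ^ (α * X.a) * (G ^ (β * X.a) * G ^ (p * X.b)) * (Real.exp (c * t * X.a) *
        (Real.exp (X.s * t) * φ ^ (1 / X.e)) ^ (X.a + X.b)) := by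
        rw [Real.rpow_add' (by positivity) hab, Real.mul_rpow (by positivity) (by positivity),
          Real.mul_rpow (by positivity) (by positivity),
          Real.mul_rpow (by positivity) (by positivity),
          Real.mul_rpow (by positivity) (by positivity : 0 ≤ Real.exp (X.s * t) * φ ^ (1 / X.e)),
          Real.rpow_mul hr, Real.rpow_mul hG, Real.rpow_mul hG, Real.exp_mul (c * t)]
        ring
    _ = _ := by
        rw [hgradient, Real.mul_rpow (by positivity) (by positivity), ← Real.exp_mul,
          ← Real.rpow_mul hφ, hcutoff, ← mul_assoc (Real.exp _), hheight]

end AbsorptionExponents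

lemma continuous_gradient {u : RSpace n → ℝ} (hu : ContDiff ℝ 1 u) : Continuous (gradient u) :=
  (InnerProductSpace.toDual ℝ (RSpace n)).symm.continuous.comp (hu.continuous_fderiv one_ne_zero)

lemma continuous_pGradient (hp : 1 < p) {u : RSpace n → ℝ} (hu : ContDiff ℝ 1 u) :
    Continuous (pGradient p u) :=
  (continuous_norm_rpow_smul (by linarith)).comp (continuous_gradient hu)

lemma norm_pGradient (hp : 1 < p) (u : RSpace n → ℝ) (x : RSpace n) :
    ‖pGradient p u x‖ = ‖gradient u x‖ ^ (p - 1) := by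
  rw [pGradient, norm_norm_rpow_smul (by linarith)]
  ring_nf

lemma fderiv_pGradient_self (hp : 1 < p) (u : RSpace n → ℝ) (x : RSpace n) :
    fderiv ℝ u x (pGradient p u x) = ‖gradient u x‖ ^ p := by
  rw [← inner_gradient_left, pGradient, inner_smul_right, real_inner_self_eq_norm_sq]
  obtain h | h := (norm_nonneg (gradient u x)).eq_or_lt
  · simp [← h, Real.zero_rpow (show p ≠ 0 by linarith)]
  · exact rpow_sub_two_mul_sq h p

/-- The weight `e^{su} φ^m` with which the differential inequality is tested. -/
noncomputable def testWeight (s m : ℝ) (u φ : RSpace n → ℝ) (x : RSpace n) : ℝ :=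
  Real.exp (s * u x) * φ x ^ m

lemma hasFDerivAt_testWeight {m : ℝ} (hm : 1 ≤ m) (s : ℝ) {u φ : RSpace n → ℝ} {x : RSpace n}
    (hu : DifferentiableAt ℝ u x) (hφ : DifferentiableAt ℝ φ x) :
    HasFDerivAt (testWeight s m u φ) ((s * testWeight s m u φ x) • fderiv ℝ u x +
      (m * (Real.exp (s * u x) * φ x ^ (m - 1))) • fderiv ℝ φ x) x := by
  refine ((hu.hasFDerivAt.const_mul s).exp.mul
    (hφ.hasFDerivAt.rpow_const (.inr hm))).congr_fderiv ?_
  ext v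
  simp [testWeight]
  ring

theorem AbsorptionExponents.exists_le_divergence_testWeight_smul
    (X : AbsorptionExponents d p α β c) (hp : 1 < p) {c₀ : ℝ} (hc₀ : 0 < c₀) :
    ∃ M, 0 ≤ M ∧ ∀ {u φ : RSpace n → ℝ} {x : RSpace n}, x ≠ 0 → DifferentiableAt ℝ u x →
      DifferentiableAt ℝ φ x → DifferentiableAt ℝ (pGradient p u) x → 0 ≤ φ x →
      c₀ * (‖x‖ ^ α * ‖gradient u x‖ ^ β * Real.exp (c * u x)) ≤
        divergence (pGradient p u) x →
      X.s / 2 * (‖gradient u x‖ ^ p * testWeight X.s (1 / X.e) u φ x) -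
          M * (‖fderiv ℝ φ x‖ * ‖x‖ ^ (-(α * X.a))) ^ (1 / X.e) ≤
        divergence (fun y => testWeight X.s (1 / X.e) u φ y • pGradient p u y) x := by
  obtain ⟨M, hM, hYoung⟩ := exists_rpow_mul_rpow_mul_le X.a_pos X.b_pos X.e_pos X.add_eq_one hc₀
    (half_pos X.s_pos)
  have hm := X.e_pos
  refine ⟨M * (1 / X.e) ^ (1 / X.e), by positivity, fun {u φ x} hx hu hφ hV hφ₀ hdiv => ?_⟩
  have hx' : 0 < ‖x‖ := norm_pos_iff.2 hx
  have hw := hasFDerivAt_testWeight X.one_le_one_div_e X.s hu hφ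
  set w := testWeight X.s (1 / X.e) u φ x with hw_def
  have hw₀ : 0 ≤ w := by simp only [hw_def, testWeight]; positivity
  set D := ‖x‖ ^ α * ‖gradient u x‖ ^ β * Real.exp (c * u x) with hD_def
  set q := 1 / X.e * (Real.exp (X.s * u x) * φ x ^ (1 / X.e - 1)) with hq
  have hq₀ : 0 ≤ q := by positivity
  have hcutoff : -(q * (‖fderiv ℝ φ x‖ * ‖gradient u x‖ ^ (p - 1))) ≤
      q * fderiv ℝ φ x (pGradient p u x) := by
    rw [← mul_neg, ← norm_pGradient hp]
    exact mul_le_mul_of_nonneg_left (abs_le.1 ((fderiv ℝ φ x).le_opNorm _)).1 hq₀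
  have habsorb : q * (‖fderiv ℝ φ x‖ * ‖gradient u x‖ ^ (p - 1)) ≤
      c₀ * (D * w) + X.s / 2 * (‖gradient u x‖ ^ p * w) +
        M * (1 / X.e * (‖fderiv ℝ φ x‖ * ‖x‖ ^ (-(α * X.a)))) ^ (1 / X.e) := by
    refine le_of_eq_of_le ?_ (hYoung (D * w) (‖gradient u x‖ ^ p * w)
      (1 / X.e * (‖fderiv ℝ φ x‖ * ‖x‖ ^ (-(α * X.a)))) (by positivity) (by positivity)
      (by positivity))
    rw [hD_def, hw_def, testWeight, X.rpow_mul_rpow hp (norm_nonneg x) (norm_nonneg _) hφ₀, hq,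
      Real.rpow_neg hx'.le]
    have := (Real.rpow_pos_of_pos hx' (α * X.a)).ne'
    field_simp
  rw [divergence_smul hw.differentiableAt hV, hw.fderiv]
  simp only [add_apply, smul_apply, smul_eq_mul, fderiv_pGradient_self hp]
  rw [Real.mul_rpow (by positivity) (by positivity)] at habsorb
  have htrace : c₀ * (D * w) ≤ w * divergence (pGradient p u) x := by
    linarith [mul_le_mul_of_nonneg_left hdiv hw₀]
  linarith

end Absorption

section Cutoff

open MeasureTheory Filter Topology

variable {n : ℕ} {R : ℝ}

/-- The smooth bump function on `ℝⁿ` equal to `1` on the unit ball and supported in the ball of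
radius `2`. -/
noncomputable def unitBump (n : ℕ) : ContDiffBump (0 : RSpace n) := ⟨1, 2, one_pos, one_lt_two⟩

/-- The dilated bump function at scale `R`. -/
noncomputable def cutoff (R : ℝ) (x : RSpace n) : ℝ := unitBump n (R⁻¹ • x)

lemma contDiff_cutoff : ContDiff ℝ 1 (cutoff R : RSpace n → ℝ) :=
  (unitBump n).contDiff.comp (contDiff_const_smul _)

lemma cutoff_nonneg (x : RSpace n) : 0 ≤ cutoff R x := (unitBump n).nonneg

lemma cutoff_le_one (x : RSpace n) : cutoff R x ≤ 1 := (unitBump n).le_one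

lemma norm_inv_smul (hR : 0 < R) (x : RSpace n) : ‖R⁻¹ • x‖ = ‖x‖ / R := by
  rw [norm_smul, norm_inv, Real.norm_of_nonneg hR.le, inv_mul_eq_div]

lemma cutoff_eq_one (hR : 0 < R) {x : RSpace n} (hx : ‖x‖ ≤ R) : cutoff R x = 1 :=
  (unitBump n).one_of_mem_closedBall (by
    simpa [norm_inv_smul hR, unitBump] using (div_le_one hR).2 hx)

lemma cutoff_eq_zero (hR : 0 < R) {x : RSpace n} (hx : 2 * R ≤ ‖x‖) : cutoff R x = 0 :=
  (unitBump n).zero_of_le_dist (by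
    simpa [norm_inv_smul hR, unitBump] using (le_div_iff₀ hR).2 hx)

lemma cutoff_le_cutoff {R' : ℝ} (hR : 0 < R) (hR' : 2 * R ≤ R') (x : RSpace n) :
    cutoff R x ≤ cutoff R' x := by
  obtain hx | hx := le_total ‖x‖ R'
  · exact (cutoff_le_one x).trans_eq (cutoff_eq_one (by linarith) hx).symm
  · exact (cutoff_eq_zero hR (hR'.trans hx)).trans_le (cutoff_nonneg x)

lemma exists_norm_fderiv_unitBump_mul_rpow_le (n : ℕ) (τ : ℝ) :
    ∃ B, 0 ≤ B ∧ ∀ y : RSpace n, ‖fderiv ℝ (unitBump n) y‖ * ‖y‖ ^ τ ≤ B := by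
  have hderiv : Continuous (fderiv ℝ (unitBump n)) :=
    (unitBump n).contDiff.continuous_fderiv one_ne_zero
  have hannulus : ContinuousOn (fun y : RSpace n => ‖fderiv ℝ (unitBump n) y‖ * ‖y‖ ^ τ)
      (Metric.closedBall 0 2 \ Metric.ball 0 1) := by
    refine hderiv.norm.continuousOn.mul (continuous_norm.continuousOn.rpow_const fun y hy => ?_)
    have : 1 ≤ ‖y‖ := by simpa using hy.2
    exact .inl (by linarith)
  obtain ⟨B, hB⟩ := ((isCompact_closedBall (0 : RSpace n) 2).diff
    Metric.isOpen_ball).exists_bound_of_continuousOn hannulus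
  refine ⟨max B 0, le_max_right .., fun y => ?_⟩
  by_cases hy : y ∈ Metric.closedBall 0 2 \ Metric.ball 0 1
  · exact (le_abs_self _).trans ((hB y hy).trans (le_max_left ..))
  suffices fderiv ℝ (unitBump n) y = 0 by simp [this]
  by_cases hy₂ : y ∈ Metric.closedBall 0 2
  · rw [((unitBump n).eventuallyEq_one_of_mem_ball
      (not_not.1 fun h => hy ⟨hy₂, h⟩)).fderiv_eq, fderiv_one, Pi.zero_apply]
  · exact Function.notMem_support.1 fun h => hy₂
      (((unitBump n).tsupport_eq ▸ support_fderiv_subset ℝ h : y ∈ Metric.closedBall 0 2))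

lemma exists_norm_fderiv_cutoff_mul_rpow_le (n : ℕ) (τ : ℝ) :
    ∃ B, 0 ≤ B ∧ ∀ R, 0 < R → ∀ x : RSpace n,
      ‖fderiv ℝ (cutoff R) x‖ * ‖x‖ ^ τ ≤ B * R ^ (τ - 1) := by
  obtain ⟨B, hB, hle⟩ := exists_norm_fderiv_unitBump_mul_rpow_le n τ
  refine ⟨B, hB, fun R hR x => ?_⟩
  calc ‖fderiv ℝ (cutoff R) x‖ * ‖x‖ ^ τ
      = R⁻¹ * ‖fderiv ℝ (unitBump n) (R⁻¹ • x)‖ * (‖R⁻¹ • x‖ * R) ^ τ := by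
        rw [norm_inv_smul hR, div_mul_cancel₀ _ hR.ne', show (cutoff R : RSpace n → ℝ) =
          fun y => unitBump n (R⁻¹ • y) from rfl, fderiv_comp_smul (f := unitBump n), norm_smul,
          norm_inv, Real.norm_of_nonneg hR.le]
    _ = ‖fderiv ℝ (unitBump n) (R⁻¹ • x)‖ * ‖R⁻¹ • x‖ ^ τ * R ^ (τ - 1) := by
        rw [Real.mul_rpow (norm_nonneg _) hR.le, Real.rpow_sub_one hR.ne']
        ring
    _ ≤ B * R ^ (τ - 1) := by gcongr; exact hle _

lemma hasCompactSupport_mul_cutoff_rpow {m : ℝ} (hm : 0 < m) (hR : 0 < R) (H : RSpace n → ℝ) :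
    HasCompactSupport fun x => H x * cutoff R x ^ m :=
  .intro (isCompact_closedBall 0 (2 * R)) fun x hx => by
    rw [cutoff_eq_zero hR (by simpa using (not_le.1 (by simpa using hx)).le),
      Real.zero_rpow hm.ne', mul_zero]

lemma continuous_cutoff_rpow {m : ℝ} (hm : 0 < m) :
    Continuous fun x : RSpace n => cutoff R x ^ m :=
  contDiff_cutoff.continuous.rpow_const fun _ => .inr hm.le

theorem eq_zero_of_integral_mul_cutoff_rpow_le {H : RSpace n → ℝ} {m : ℝ} {g : ℝ → ℝ}
    (hm : 0 < m) (hH : Continuous H) (hH₀ : ∀ x, 0 ≤ H x)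
    (hle : ∀ R, 0 < R → ∫ x, H x * cutoff R x ^ m ≤ g R) (hg : Tendsto g atTop (𝓝 0))
    (x : RSpace n) : H x = 0 := by
  by_contra hx
  set R₀ := ‖x‖ + 1
  have hR₀ : 0 < R₀ := by positivity
  have hcont : ∀ R, Continuous fun y => H y * cutoff R y ^ m := fun R =>
    hH.mul (continuous_cutoff_rpow hm)
  have hint : ∀ R, 0 < R → Integrable fun y => H y * cutoff R y ^ m := fun R hR =>
    (hcont R).integrable_of_hasCompactSupport (hasCompactSupport_mul_cutoff_rpow hm hR H)
  have hpos : 0 < ∫ y, H y * cutoff R₀ y ^ m :=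
    (hcont R₀).integral_pos_of_hasCompactSupport_nonneg_nonzero
      (hasCompactSupport_mul_cutoff_rpow hm hR₀ H)
      (fun y => mul_nonneg (hH₀ y) (Real.rpow_nonneg (cutoff_nonneg y) m)) (x := x)
      (by simpa [cutoff_eq_one hR₀ (show ‖x‖ ≤ R₀ by linarith)] using hx)
  refine hpos.not_ge (ge_of_tendsto hg ?_)
  filter_upwards [eventually_ge_atTop (2 * R₀)] with R hR
  refine (integral_mono (hint R₀ hR₀) (hint R (by linarith)) fun y => ?_).trans
    (hle R (by linarith))
  have := hH₀ y
  have := cutoff_nonneg (R := R₀) y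
  dsimp only
  gcongr
  exact cutoff_le_cutoff hR₀ hR y

end Cutoff

section Liouville

open MeasureTheory

variable {n : ℕ} {p α β c : ℝ}

lemma AbsorptionExponents.exists_remainder_le (X : AbsorptionExponents n p α β c) :
    ∃ B, ∀ R, 0 < R → ∀ x : RSpace n,
      (‖fderiv ℝ (cutoff R) x‖ * ‖x‖ ^ (-(α * X.a))) ^ (1 / X.e) ≤ B * R ^ (-(n + p)) := by
  obtain ⟨B, hB, hle⟩ := exists_norm_fderiv_cutoff_mul_rpow_le n (-(α * X.a))
  refine ⟨B ^ (1 / X.e), fun R hR x => ?_⟩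
  calc _ ≤ (B * R ^ (-(α * X.a) - 1)) ^ (1 / X.e) :=
        Real.rpow_le_rpow (by positivity) (hle R hR x) (one_div_nonneg.2 X.e_pos.le)
    _ = B ^ (1 / X.e) * R ^ (-(n + p)) := by
        rw [Real.mul_rpow hB (by positivity), ← Real.rpow_mul hR.le, ← neg_add', X.scaling,
          neg_mul, mul_one_div, mul_div_cancel_left₀ _ X.e_pos.ne']

lemma exists_integral_le_rpow_neg {c₀ : ℝ} (X : AbsorptionExponents (n + 1 : ℕ) p α β c)
    (hp : 1 < p) (hc₀ : 0 < c₀) {u : RSpace (n + 1) → ℝ} (hu : ContDiff ℝ 1 u)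
    (hV : ∀ x, x ≠ 0 → DifferentiableAt ℝ (pGradient p u) x)
    (hdiv : ∀ x, x ≠ 0 → c₀ * (‖x‖ ^ α * ‖gradient u x‖ ^ β * Real.exp (c * u x)) ≤
      divergence (pGradient p u) x) :
    ∃ M, ∀ R, 0 < R →
      ∫ x, ‖gradient u x‖ ^ p * testWeight X.s (1 / X.e) u (cutoff R) x ≤ M * R ^ (-p) := by
  obtain ⟨M, hM, hle⟩ := X.exists_le_divergence_testWeight_smul (n := n + 1) hp hc₀
  obtain ⟨B, hremainder⟩ := X.exists_remainder_le
  refine ⟨2 / X.s * (M * B * 4 ^ (n + 1)), fun R hR => ?_⟩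
  have hw : ∀ x, DifferentiableAt ℝ (testWeight X.s (1 / X.e) u (cutoff R)) x := fun x =>
    (hasFDerivAt_testWeight X.one_le_one_div_e X.s (hu.differentiable one_ne_zero x)
      (contDiff_cutoff.differentiable one_ne_zero x)).differentiableAt
  have hw_cont : Continuous (testWeight X.s (1 / X.e) u (cutoff R)) :=
    continuous_iff_continuousAt.2 fun x => (hw x).continuousAt
  have hw₀ : ∀ x, 2 * R ≤ ‖x‖ → testWeight X.s (1 / X.e) u (cutoff R) x = 0 := fun x hx => by
    simp [testWeight, cutoff_eq_zero hR hx, Real.zero_rpow, X.e_pos.ne']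
  have hintegral := integral_le_of_sub_le_divergence (ρ := 2 * R)
    (G := fun x => X.s / 2 * (‖gradient u x‖ ^ p * testWeight X.s (1 / X.e) u (cutoff R) x))
    (Set.countable_singleton 0) (by positivity) (hw_cont.smul (continuous_pGradient hp hu))
    (fun x hx => (hw x).smul (hV x hx)) (fun x hx => by rw [Pi.smul_apply', hw₀ x hx, zero_smul])
    (continuous_const.mul (((continuous_gradient hu).norm.rpow_const
      fun _ => .inr (by linarith)).mul hw_cont)) (fun x hx => by rw [hw₀ x hx, mul_zero, mul_zero])
    fun x hx => (sub_le_sub_left (mul_le_mul_of_nonneg_left (hremainder R hR x) hM) _).trans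
      (hle hx (hu.differentiable one_ne_zero x) (contDiff_cutoff.differentiable one_ne_zero x)
        (hV x hx) (cutoff_nonneg x) (hdiv x hx))
  have hR_pow : R ^ (-((n + 1 : ℕ) + p)) * R ^ (n + 1) = R ^ (-p) := by
    rw [← Real.rpow_natCast R (n + 1), ← Real.rpow_add hR]
    ring_nf
  have hs := X.s_pos
  rw [integral_const_mul] at hintegral
  calc _ = 2 / X.s * (X.s / 2 *
        ∫ x, ‖gradient u x‖ ^ p * testWeight X.s (1 / X.e) u (cutoff R) x) := by field_simp
    _ ≤ 2 / X.s * (M * (B * R ^ (-((n + 1 : ℕ) + p))) * (2 * (2 * R)) ^ (n + 1)) := by gcongr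
    _ = _ := by
        rw [← hR_pow]
        ring

theorem eq_of_le_divergence_pGradient {c₀ : ℝ} (hp : 1 < p) (hα : -1 < α) (hβ : β < p - 1)
    (hc : 0 < c) (hc₀ : 0 < c₀) {u : RSpace (n + 1) → ℝ} (hu : ContDiff ℝ 1 u)
    (hV : ∀ x, x ≠ 0 → DifferentiableAt ℝ (pGradient p u) x)
    (hdiv : ∀ x, x ≠ 0 → c₀ * (‖x‖ ^ α * ‖gradient u x‖ ^ β * Real.exp (c * u x)) ≤
      divergence (pGradient p u) x) (x y : RSpace (n + 1)) : u x = u y := by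
  obtain ⟨X⟩ := nonempty_absorptionExponents (d := (n + 1 : ℕ)) (by positivity) hp hα hβ hc
  obtain ⟨M, hM⟩ := exists_integral_le_rpow_neg X hp hc₀ hu hV hdiv
  have henergy : ∀ z, ‖gradient u z‖ ^ p * Real.exp (X.s * u z) = 0 :=
    eq_zero_of_integral_mul_cutoff_rpow_le (one_div_pos.2 X.e_pos)
      (((continuous_gradient hu).norm.rpow_const fun _ => .inr (by linarith)).mul
        (Real.continuous_exp.comp (continuous_const.mul hu.continuous))) (fun z => by positivity)
      (by simpa only [testWeight, ← mul_assoc] using hM)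
      (by simpa using (tendsto_rpow_neg_atTop (show 0 < p by linarith)).const_mul M)
  refine is_const_of_fderiv_eq_zero (𝕜 := ℝ) (hu.differentiable one_ne_zero) (fun z => ?_) x y
  have hgradient : ‖gradient u z‖ = 0 := (Real.rpow_eq_zero (norm_nonneg _) (by linarith)).1
    ((mul_eq_zero_iff_right (Real.exp_ne_zero _)).1 (henergy z))
  simpa [gradient] using norm_eq_zero.1 hgradient

end Liouville

section Existence

variable {n : ℕ} {K : Set (Fin (n + 1) → ℝ)} {F : (Fin (n + 1) → ℝ) → ℝ} {p α β c : ℝ}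

lemma nonpos_of_isAdmissibleSubsolution_exp (hKF : IsTraceComparable K F) (hp : 1 < p)
    (hα : -1 < α) (hβ : β < p - 1) {u : RSpace (n + 1) → ℝ} (hu : ContDiff ℝ 1 u)
    (h : IsAdmissibleSubsolution K F p α β (fun t => Real.exp (c * t)) u) : c ≤ 0 := by
  by_contra! hc
  obtain ⟨⟨x, y, hxy⟩, hsub⟩ := h
  obtain ⟨C, hC, hF⟩ := hKF.exists_le_mul_sum
  refine hxy (eq_of_le_divergence_pGradient hp hα hβ hc (inv_pos.2 hC) hu
    (fun x hx => (hsub x hx).1) (fun x hx => ?_) x y)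
  obtain ⟨-, -, lam, hlam, hK, hle⟩ := hsub x hx
  rw [divergence, hlam.trace_eq_sum, inv_mul_le_iff₀ hC]
  exact hle.trans (hF lam hK)

theorem corollary1p1_general (hKF : IsTraceComparable K F) (hp : 1 < p) (hα : -1 < α)
    (hβ : β < p - 1) :
    (p ≤ α + β + 2 →
        ((∃ u : RSpace (n + 1) → ℝ, ContDiff ℝ 2 u ∧
            IsAdmissibleSubsolution K F p α β (fun t => Real.exp (c * t)) u) ↔ c ≤ 0)) ∧
      (α + β + 2 < p → ∀ δ : ℝ, 1 ≤ δ → δ < (p - β - 1) / (p - α - β - 2) →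
        ((∃ u : RSpace (n + 1) → ℝ, ContDiff ℝ 1 u ∧ ContDiffOn ℝ 2 u {0}ᶜ ∧
            MemSobolevTwoLocal δ u ∧
            IsAdmissibleSubsolution K F p α β (fun t => Real.exp (c * t)) u) ↔ c ≤ 0)) ∧
      ((∃ u : RSpace (n + 1) → ℝ, ContDiff ℝ 1 u ∧ ContDiffOn ℝ 2 u {0}ᶜ ∧
          IsAdmissibleSubsolution K F p α β (fun t => Real.exp (c * t)) u) ↔ c ≤ 0) := by
  have hγ := one_lt_radialExponent hα hβ
  have hexists (hc : c ≤ 0) := exists_isAdmissibleSubsolution_radialPower hKF hp hα hβ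
    fun t ht => Real.exp_le_one_iff.2 (mul_nonpos_of_nonpos_of_nonneg hc ht)
  refine ⟨fun h => ⟨fun ⟨u, hu, hsub⟩ => ?_, fun hc => ?_⟩,
    fun h δ hδ₁ hδ => ⟨fun ⟨u, hu, _, _, hsub⟩ => ?_, fun hc => ?_⟩,
    fun ⟨u, hu, _, hsub⟩ => ?_, fun hc => ?_⟩
  · exact nonpos_of_isAdmissibleSubsolution_exp hKF hp hα hβ (hu.of_le one_le_two) hsub
  · obtain ⟨C, hsub⟩ := hexists hc
    exact ⟨_, contDiff_two_radialPower (two_le_radialExponent hβ h), hsub⟩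
  · exact nonpos_of_isAdmissibleSubsolution_exp hKF hp hα hβ hu hsub
  · obtain ⟨C, hsub⟩ := hexists hc
    exact ⟨_, contDiff_radialPower hγ, contDiffOn_radialPower, memSobolevTwoLocal_radialPower hγ hδ₁
      (neg_one_lt_radialExponent_sub_two_mul hβ h hδ), hsub⟩
  · exact nonpos_of_isAdmissibleSubsolution_exp hKF hp hα hβ hu hsub
  · obtain ⟨C, hsub⟩ := hexists hc
    exact ⟨_, contDiff_radialPower hγ, contDiffOn_radialPower, hsub⟩

end Existence

theorem corollary1p1 (n k : ℕ) (hk : 1 ≤ k) (hkn : k ≤ n)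
    (p α β c : ℝ) (hp : 1 < p) (hα : -1 < α) (hβ : β < p - 1) (hc : 0 ≤ c) :
    -- the `k`-Hessian type equation
    ((p ≤ α + β + 2 →
        ((∃ u : RSpace n → ℝ, ContDiff ℝ 2 u ∧
            IsSubsolutionS k p α β (fun t => Real.exp (c * t)) u) ↔ c = 0)) ∧
      (α + β + 2 < p → 0 ≤ (p - 1) * α + β →
        ∀ δ : ℝ, 1 < δ → δ < (p - β - 1) / (p - α - β - 2) →
        ((∃ u : RSpace n → ℝ, ContDiff ℝ 1 u ∧ ContDiffOn ℝ 2 u {0}ᶜ ∧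
            MemSobolevTwoLocal δ u ∧
            IsSubsolutionS k p α β (fun t => Real.exp (c * t)) u) ↔ c = 0)) ∧
      (α < 1 / (k : ℝ) - 1 →
        ((∃ u : RSpace n → ℝ, ContDiff ℝ 1 u ∧ ContDiffOn ℝ 2 u {0}ᶜ ∧
            IsSubsolutionS k p α β (fun t => Real.exp (c * t)) u) ↔ c = 0))) ∧
    -- the `Π_k`-Hessian type equation
    ((p ≤ α + β + 2 →
        ((∃ u : RSpace n → ℝ, ContDiff ℝ 2 u ∧
            IsSubsolutionPi k p α β (fun t => Real.exp (c * t)) u) ↔ c = 0)) ∧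
      (α + β + 2 < p → 0 ≤ (p - 1) * α + β →
        ∀ δ : ℝ, 1 < δ → δ < (p - β - 1) / (p - α - β - 2) →
        ((∃ u : RSpace n → ℝ, ContDiff ℝ 1 u ∧ ContDiffOn ℝ 2 u {0}ᶜ ∧
            MemSobolevTwoLocal δ u ∧
            IsSubsolutionPi k p α β (fun t => Real.exp (c * t)) u) ↔ c = 0)) ∧
      (α < (k : ℝ) / (n : ℝ) - 1 →
        ((∃ u : RSpace n → ℝ, ContDiff ℝ 1 u ∧ ContDiffOn ℝ 2 u {0}ᶜ ∧
            IsSubsolutionPi k p α β (fun t => Real.exp (c * t)) u) ↔ c = 0))) := by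
  obtain ⟨n, rfl⟩ := Nat.exists_eq_add_of_le' (hk.trans hkn)
  have hc' : c ≤ 0 ↔ c = 0 := ⟨fun h => h.antisymm hc, le_of_eq⟩
  have hS := corollary1p1_general (c := c) (isTraceComparable_sumOfProducts hk hkn) hp hα hβ
  have hP := corollary1p1_general (c := c) (isTraceComparable_productOfSums hk hkn) hp hα hβ
  simp only [hc'] at hS hP
  exact ⟨⟨hS.1, fun h _ δ hδ => hS.2.1 h δ hδ.le, fun _ => hS.2.2⟩,
    hP.1, fun h _ δ hδ => hP.2.1 h δ hδ.le, fun _ => hP.2.2⟩
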